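/- **Setting.** An *unbounded distributive pre-bilattice* is an algebra $(A;\lor_t,\land_t,\lor_k,\land_k)$ such that $(A;\lor_t,\land_t)$ and $(A;\lor_k,\land_k)$ are lattices and each of the four operations distributes over each of the other three. A *distributive pre-bilattice* is an algebra $\mathbf A=(A;\lor_t,\land_t,0_t,1_t,0_k,1_k)$ such that, with $$a\lor_k b=((a\land_t b)\land_t 0_k)\lor_t((a\lor_t b)\land_t 1_k),\qquad a\land_k b=((a\land_t b)\land_t 1_k)\lor_t((a\lor_t b)\land_t 0_k),$$ $(A;\lor_t,\land_t,\lor_k,\land_k)$ is an unbounded distributive pre-bilattice, $0_t,1_t$ are the bounds of $(A;\lor_t,\land_t)$ and $0_k,1_k$ are the bounds of $(A;\lor_k,\land_k)$. Let $\mathsf{DPB}$ be the class, and the category with all homomorphisms, of distributive pre-bilattices; write $a\le_k b$ for $a\land_k b=a$. Let $\mathbf 2^+$ and $\mathbf 2^-$ be the algebras on $\{0,1\}$ whose $t$-lattice is the chain $0<1$ (so $0_t=0$, $1_t=1$), with $0_k=0$, $1_k=1$ in $\mathbf 2^+$ and $0_k=1$, $1_k=0$ in $\mathbf 2^-$. Consider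 two-sorted structures $X=X_+\,\dot\cup\,X_-$, where each sort is a topological space with a binary relation; morphisms are the continuous maps that preserve sorts and relations. Let $\widetilde{\mathcal M}$ be the structure with sorts $\{0^+,1^+\}$ and $\{0^-,1^-\}$, discretely topologised, whose relations $r^+$, $r^-$ are the orders $\le_k$ of $\mathbf 2^+$ and $\mathbf 2^-$. For a set $S$, the power $\widetilde{\mathcal M}^S$ has sorts $(\mathbf 2^{\pm})^S$, with product topology and pointwise relations. Let $\mathcal X=\mathbb{IS}_c\mathbb P(\widetilde{\mathcal M})$ be the category of isomorphic copies of closed substructures (sorts may be empty) of powers $\widetilde{\mathcal M}^S$, $S\neq\emptyset$. Let $D(\mathbf A)=\mathsf{DPB}(\mathbf A,\mathbf 2^+)\,\dot\cup\,\mathsf{DPB}(\mathbf A,\mathbf 2^-)$, viewed as a substructure of $\widetilde{\mathcal M}^A$, and let $E(X)=\mathcal X(X,\widetilde{\mathcal M})$ with pointwise operations; both are contravariant functors, acting on morphisms by composition. Let $e_{\mathbf A}\colon\mathbf A\to ED(\mathbf A)$, $e_{\mathbf A}(a)(x)=x(a)$, and $\varepsilon_X\colon X\to DE(X)$, $\varepsilon_X(x)(f)=f(x)$,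 be the evaluation maps. $\widetilde{\mathcal M}$ *yields a duality* if every $e_{\mathbf A}$ is an isomorphism, and a *full duality* if moreover every $\varepsilon_X$ is an isomorphism. It *yields a strong duality* if it yields a duality and every closed substructure $C$ of every power $\widetilde{\mathcal M}^S$, $S\ne\emptyset$, is term-closed: for each point $y$ of $\widetilde{\mathcal M}^S$ outside $C$ there are $S$-ary terms $p,q$ whose term functions agree on both sorts of $C$ but not at $y$. **Theorem.** 1. $\mathsf{DPB}=\mathbb{ISP}(\mathbf 2^+,\mathbf 2^-)$: an algebra of the above type is a distributive pre-bilattice if and only if it is isomorphic to a subalgebra of a product of algebras each of which is $\mathbf 2^+$ or $\mathbf 2^-$. 2. $\widetilde{\mathcal M}$ yields a strong duality on $\mathsf{DPB}$. In particular this duality is full, and $\widetilde{\mathcal M}$ is injective in $\mathcal X$ with respect to embeddings (isomorphisms onto closed substructures). 3. $D$ and $E$ set up a dual equivalence between $\mathsf{DPB}$ and $\mathcal X$ whose unit and counit are given by the evaluation maps. 4. A two-sorted structure belongs to $\mathcal X$ if and only if each of its sorts, with its topology and relation, is a Priestley space; and the functor $F\colon X\mapsto(X_+,X_-)$ (restricting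 morphisms to the sorts) is an equivalence from $\mathcal X$ to $\mathcal P\times\mathcal P$, where $\mathcal P$ is the category of Priestley spaces and continuous order-preserving maps. 5. Let $\mathcal D$ be the category of bounded distributive lattices and bound-preserving lattice homomorphisms, and let $K\colon\mathcal P\to\mathcal D$ be the contravariant functor that sends a Priestley space to its lattice of clopen up-sets and a morphism to inverse image. Then the composite functor $\mathbf A\mapsto (K\times K)(F(D(\mathbf A)))$ is an equivalence of categories from $\mathsf{DPB}$ to $\mathcal D\times\mathcal D$. -/

import Mathlib

open CategoryTheory Opposite

universe u v w

namespace PreBilat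

/-! ### Algebras of the type of bounded distributive pre-bilattices -/

/-- The operations `∨_t, ∧_t, 0_t, 1_t, 0_k, 1_k` (no laws are required). -/
class Ops (A : Type u) where
  supT : A → A → A
  infT : A → A → A
  zeroT : A
  oneT : A
  zeroK : A
  oneK : A

open Ops

section Laws

variable {A : Type u}

/-- The derived operation `∨_k`. -/
def supK [Ops A] (a b : A) : A :=
  supT (infT (infT a b) zeroK) (infT (supT a b) oneK)

/-- The derived operation `∧_k`. -/
def infK [Ops A] (a b : A) : A :=
  supT (infT (infT a b) oneK) (infT (supT a b) zeroK)

/-- The knowledge order: `a ≤_k b` iff `a ∧_k b = a`. -/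
def leK [Ops A] (a b : A) : Prop := infK a b = a

/-- `(A; j, m)` is a lattice with join `j` and meet `m`. -/
structure IsLatticePair (j m : A → A → A) : Prop where
  sup_comm : ∀ a b, j a b = j b a
  inf_comm : ∀ a b, m a b = m b a
  sup_assoc : ∀ a b c, j (j a b) c = j a (j b c)
  inf_assoc : ∀ a b c, m (m a b) c = m a (m b c)
  sup_inf_self : ∀ a b, j a (m a b) = a
  inf_sup_self : ∀ a b, m a (j a b) = a

/-- The (commutative) operation `f` distributes over `g`. -/
def Distributes (f g : A → A → A) : Prop :=
  ∀ a b c, f a (g b c) = g (f a b) (f a c)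

/-- Unbounded distributive pre-bilattices: two lattice structures such that each of the four
operations distributes over each of the other three. -/
structure IsUnboundedDPB (jt mt jk mk : A → A → A) : Prop where
  t_lattice : IsLatticePair jt mt
  k_lattice : IsLatticePair jk mk
  jt_mt : Distributes jt mt
  jt_jk : Distributes jt jk
  jt_mk : Distributes jt mk
  mt_jt : Distributes mt jt
  mt_jk : Distributes mt jk
  mt_mk : Distributes mt mk
  jk_jt : Distributes jk jt
  jk_mt : Distributes jk mt
  jk_mk : Distributes jk mk
  mk_jt : Distributes mk jt
  mk_mt : Distributes mk mt
  mk_jk : Distributes mk jk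

variable (A) in
/-- The algebra `A` is a distributive pre-bilattice. -/
structure IsDPB [Ops A] : Prop where
  pre : IsUnboundedDPB (A := A) supT infT supK infK
  zeroT_sup : ∀ a : A, supT zeroT a = a
  oneT_inf : ∀ a : A, infT oneT a = a
  zeroK_sup : ∀ a : A, supK zeroK a = a
  oneK_inf : ∀ a : A, infK oneK a = a

end Laws

/-- Homomorphisms: maps preserving `∨_t, ∧_t, 0_t, 1_t, 0_k, 1_k`. -/
@[ext]
structure Hom (A : Type u) (B : Type v) [Ops A] [Ops B] where
  toFun : A → B
  map_supT : ∀ a b, toFun (supT a b) = supT (toFun a) (toFun b)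
  map_infT : ∀ a b, toFun (infT a b) = infT (toFun a) (toFun b)
  map_zeroT : toFun zeroT = zeroT
  map_oneT : toFun oneT = oneT
  map_zeroK : toFun zeroK = zeroK
  map_oneK : toFun oneK = oneK

/-- The identity homomorphism. -/
def Hom.id (A : Type u) [Ops A] : Hom A A :=
  ⟨fun a => a, fun _ _ => rfl, fun _ _ => rfl, rfl, rfl, rfl, rfl⟩

/-- Composition of homomorphisms (first `f`, then `g`). -/
def Hom.comp {A : Type u} {B : Type v} {C : Type w} [Ops A] [Ops B] [Ops C]
    (f : Hom A B) (g : Hom B C) : Hom A C where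
  toFun a := g.toFun (f.toFun a)
  map_supT a b := by rw [f.map_supT, g.map_supT]
  map_infT a b := by rw [f.map_infT, g.map_infT]
  map_zeroT := by rw [f.map_zeroT, g.map_zeroT]
  map_oneT := by rw [f.map_oneT, g.map_oneT]
  map_zeroK := by rw [f.map_zeroK, g.map_zeroK]
  map_oneK := by rw [f.map_oneK, g.map_oneK]

/-- The variety of distributive pre-bilattices as a category, with all homomorphisms. -/
structure DPB : Type (u + 1) where
  carrier : Type u
  [ops : Ops carrier]
  isDPB : IsDPB carrier

attribute [instance] DPB.ops

instance : Category DPB.{u} where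
  Hom A B := Hom A.carrier B.carrier
  id A := Hom.id A.carrier
  comp f g := f.comp g

/-! ### The two-element algebras and `ISP` -/

/-- The two labels `+` and `-` for the generating algebras and for the sorts. -/
inductive Sgn where
  | plus
  | minus
  deriving DecidableEq

/-- The underlying set `{0, 1}` of the two-element algebra with label `s`
(`false` is `0`, `true` is `1`). -/
def Two (_ : Sgn) : Type := Bool

instance (s : Sgn) : DecidableEq (Two s) := inferInstanceAs (DecidableEq Bool)
instance (s : Sgn) : Fintype (Two s) := inferInstanceAs (Fintype Bool)

/-- The discrete topology. -/
instance (s : Sgn) : TopologicalSpace (Two s) := ⊥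
instance (s : Sgn) : DiscreteTopology (Two s) := ⟨rfl⟩

/-- `Two .plus` is the algebra `2⁺`, with `0_t = 0_k = 0` and `1_t = 1_k = 1`;
`Two .minus` is the algebra `2⁻`, with `0_t = 1_k = 0` and `1_t = 0_k = 1`.
In both the truth lattice is the chain `0 < 1`. -/
instance (s : Sgn) : Ops (Two s) where
  supT a b := Bool.or a b
  infT a b := Bool.and a b
  zeroT := false
  oneT := true
  zeroK := match s with
    | .plus => false
    | .minus => true
  oneK := match s with
    | .plus => true
    | .minus => false

instance (s : Sgn) (a b : Two s) : Decidable (leK a b) :=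
  inferInstanceAs (Decidable (infK a b = a))

/-- On `2⁺` the orders `≤_k` and `≤_t` coincide. -/
theorem leK_plus_iff : ∀ a b : Two .plus, leK a b ↔ infT a b = a := by decide

/-- On `2⁻` the order `≤_k` is the converse of `≤_t`. -/
theorem leK_minus_iff : ∀ a b : Two .minus, leK a b ↔ infT b a = b := by decide

theorem isDPB_two (s : Sgn) : IsDPB (Two s) := by
  cases s <;> refine ⟨⟨⟨?_, ?_, ?_, ?_, ?_, ?_⟩, ⟨?_, ?_, ?_, ?_, ?_, ?_⟩,
    ?_, ?_, ?_, ?_, ?_, ?_, ?_, ?_, ?_, ?_, ?_, ?_⟩, ?_, ?_, ?_, ?_⟩ <;>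
    (try unfold Distributes) <;> decide

theorem leK_two_supT {s : Sgn} : ∀ {a b c d : Two s}, leK a b → leK c d →
    leK (supT a c) (supT b d) := by cases s <;> decide

theorem leK_two_infT {s : Sgn} : ∀ {a b c d : Two s}, leK a b → leK c d →
    leK (infT a c) (infT b d) := by cases s <;> decide

theorem leK_two_refl {s : Sgn} : ∀ a : Two s, leK a a := by cases s <;> decide

theorem leK_two_trans {s : Sgn} : ∀ {a b c : Two s}, leK a b → leK b c → leK a c := by
  cases s <;> decide

theorem leK_two_antisymm {s : Sgn} : ∀ {a b : Two s}, leK a b → leK b a → a = b := by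
  cases s <;> decide

/-- Operations on a product are pointwise. -/
instance {I : Type u} (M : I → Type v) [∀ i, Ops (M i)] : Ops (∀ i, M i) where
  supT f g := fun i => supT (f i) (g i)
  infT f g := fun i => infT (f i) (g i)
  zeroT := fun _ => zeroT
  oneT := fun _ => oneT
  zeroK := fun _ => zeroK
  oneK := fun _ => oneK

/-- `A` belongs to `ISP(2⁺, 2⁻)`: it embeds into (equivalently, it is isomorphic to a subalgebra
of) a product of a family of algebras each of which is `2⁺` or `2⁻`. -/
def InISP (A : Type u) [Ops A] : Prop :=
  ∃ (I : Type u) (sgn : I → Sgn) (φ : Hom A (∀ i, Two (sgn i))), Function.Injective φ.toFun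

/-! ### Two-sorted topological structures and `IS_cP` of the alter ego -/

/-- A structure with two sorts, each a topological space with a binary relation. The underlying
space is the disjoint union of the sorts. -/
structure TwoSorted : Type (u + 1) where
  carrier : Sgn → Type u
  [top : ∀ s, TopologicalSpace (carrier s)]
  rel : ∀ s, carrier s → carrier s → Prop

attribute [instance] TwoSorted.top

/-- Morphisms: continuous, sort-preserving and relation-preserving maps. -/
@[ext]
structure SHom (X : TwoSorted.{u}) (Y : TwoSorted.{v}) where
  toFun : ∀ s, X.carrier s → Y.carrier s
  continuous_toFun : ∀ s, Continuous (toFun s)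
  map_rel : ∀ s x y, X.rel s x y → Y.rel s (toFun s x) (toFun s y)

/-- The identity morphism. -/
def SHom.id (X : TwoSorted.{u}) : SHom X X :=
  ⟨fun _ x => x, fun _ => continuous_id, fun _ _ _ h => h⟩

/-- Composition of morphisms (first `f`, then `g`). -/
def SHom.comp {X : TwoSorted.{u}} {Y : TwoSorted.{v}} {Z : TwoSorted.{w}}
    (f : SHom X Y) (g : SHom Y Z) : SHom X Z where
  toFun s x := g.toFun s (f.toFun s x)
  continuous_toFun s := (g.continuous_toFun s).comp (f.continuous_toFun s)
  map_rel s _ _ h := g.map_rel s _ _ (f.map_rel s _ _ h)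

/-- `φ` is an isomorphism onto a closed substructure. -/
def SHom.IsClosedEmb {X : TwoSorted.{u}} {Y : TwoSorted.{v}} (φ : SHom X Y) : Prop :=
  ∀ s, Topology.IsClosedEmbedding (φ.toFun s) ∧
    ∀ x y, X.rel s x y ↔ Y.rel s (φ.toFun s x) (φ.toFun s y)

/-- The alter ego: the sorts are the discretely topologised sets `2⁺` and `2⁻`, with the order
`≤_k` on each. -/
def alterEgo : TwoSorted.{0} where
  carrier := Two
  rel _ a b := leK a b

/-- The power of the alter ego with exponent `S`, formed by sorts: product topology and
pointwise relations. -/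
def power (S : Type u) : TwoSorted.{u} where
  carrier s := S → Two s
  rel _ x y := ∀ i, leK (x i) (y i)

/-- `X` belongs to `IS_cP` of the alter ego: it is isomorphic to a closed substructure of a
non-empty power of the alter ego. -/
def InIScP (X : TwoSorted.{u}) : Prop :=
  ∃ (S : Type u) (_ : Nonempty S) (φ : SHom X (power S)), φ.IsClosedEmb

/-- The dual category `X = IS_cP` of the alter ego. -/
structure DualCat : Type (u + 1) where
  str : TwoSorted.{u}
  mem : InIScP str

instance : Category DualCat.{u} where
  Hom X Y := SHom X.str Y.str
  id X := SHom.id X.str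
  comp f g := f.comp g

/-! ### The hom-functors and the evaluation maps -/

/-- The hom-sets `DPB(A, 2⁺)` and `DPB(A, 2⁻)`, as a substructure of the power with exponent `A`:
the topology is that of pointwise convergence and the relations are pointwise. -/
def homStr (A : Type u) [Ops A] : TwoSorted.{u} where
  carrier s := Hom A (Two s)
  top s := TopologicalSpace.induced (fun x : Hom A (Two s) => x.toFun) inferInstance
  rel _ x y := ∀ a, leK (x.toFun a) (y.toFun a)

theorem continuous_homStr_toFun (A : Type u) [Ops A] (s : Sgn) :
    Continuous (fun x : (homStr A).carrier s => (Hom.toFun x : A → Two s)) :=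
  continuous_induced_dom

theorem homStr_mem (A : Type u) [Ops A] : InIScP (homStr A) := by
  refine ⟨A, ⟨zeroT⟩, ⟨fun s x => Hom.toFun x, continuous_homStr_toFun A,
    fun _ _ _ h => h⟩, fun s => ⟨⟨⟨⟨rfl⟩, fun x y h => Hom.ext h⟩, ?_⟩, fun _ _ => Iff.rfl⟩⟩
  have hr : Set.range (fun x : (homStr A).carrier s => (Hom.toFun x : A → Two s)) =
      {f : A → Two s | (∀ a b, f (supT a b) = supT (f a) (f b)) ∧
        (∀ a b, f (infT a b) = infT (f a) (f b)) ∧ f zeroT = zeroT ∧ f oneT = oneT ∧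
        f zeroK = zeroK ∧ f oneK = oneK} := by
    ext f
    constructor
    · rintro ⟨x, rfl⟩
      exact ⟨x.map_supT, x.map_infT, x.map_zeroT, x.map_oneT, x.map_zeroK, x.map_oneK⟩
    · rintro ⟨h1, h2, h3, h4, h5, h6⟩
      exact ⟨⟨f, h1, h2, h3, h4, h5, h6⟩, rfl⟩
  have hop : ∀ (o : Two s → Two s → Two s) (a b : A),
      Continuous fun f : A → Two s => o (f a) (f b) := fun o a b =>
    (continuous_of_discreteTopology (f := fun p : Two s × Two s => o p.1 p.2)).comp
      (g := fun p : Two s × Two s => o p.1 p.2) (f := fun f : A → Two s => (f a, f b))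
      ((continuous_apply a).prodMk (continuous_apply b))
  change IsClosed (Set.range (fun x : (homStr A).carrier s => (Hom.toFun x : A → Two s)))
  rw [hr]
  simp only [Set.ofPred_and, Set.ofPred_forall]
  refine (isClosed_iInter fun a => isClosed_iInter fun b =>
    isClosed_eq (continuous_apply _) (hop _ a b)).inter <|
    (isClosed_iInter fun a => isClosed_iInter fun b =>
      isClosed_eq (continuous_apply _) (hop _ a b)).inter <|
    (isClosed_eq (continuous_apply _) continuous_const).inter <|
    (isClosed_eq (continuous_apply _) continuous_const).inter <|
    (isClosed_eq (continuous_apply _) continuous_const).inter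
    (isClosed_eq (continuous_apply _) continuous_const)

/-- The functor `D = DPB(-, {2⁺, 2⁻})`, acting on morphisms by composition. -/
def functorD : DPB.{u}ᵒᵖ ⥤ DualCat.{u} where
  obj A := ⟨homStr A.unop.carrier, homStr_mem _⟩
  map {A B} f :=
    { toFun := fun _ x => Hom.comp (show Hom B.unop.carrier A.unop.carrier from f.unop) x
      continuous_toFun := fun s => continuous_induced_rng.2 <| continuous_pi fun b =>
        (continuous_apply ((show Hom B.unop.carrier A.unop.carrier from f.unop).toFun b)).comp
          (continuous_homStr_toFun A.unop.carrier s)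
      map_rel := fun _ _ _ h b => h _ }

/-- The morphisms from `X` into the alter ego, with pointwise operations (that is, as a
subalgebra of the product of copies of `2⁺` indexed by `X_+` and of `2⁻` indexed by `X_-`). -/
instance (X : TwoSorted.{u}) : Ops (SHom X alterEgo) where
  supT f g :=
    { toFun := fun s x => (supT (f.toFun s x : Two s) (g.toFun s x) : Two s)
      continuous_toFun := fun s =>
        (continuous_of_discreteTopology (f := fun p : Two s × Two s => supT p.1 p.2)).comp
          ((f.continuous_toFun s).prodMk (g.continuous_toFun s))
      map_rel := fun s x y h => leK_two_supT (f.map_rel s x y h) (g.map_rel s x y h) }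
  infT f g :=
    { toFun := fun s x => (infT (f.toFun s x : Two s) (g.toFun s x) : Two s)
      continuous_toFun := fun s =>
        (continuous_of_discreteTopology (f := fun p : Two s × Two s => infT p.1 p.2)).comp
          ((f.continuous_toFun s).prodMk (g.continuous_toFun s))
      map_rel := fun s x y h => leK_two_infT (f.map_rel s x y h) (g.map_rel s x y h) }
  zeroT := ⟨fun s _ => (zeroT : Two s), fun _ => continuous_const, fun _ _ _ _ => leK_two_refl _⟩
  oneT := ⟨fun s _ => (oneT : Two s), fun _ => continuous_const, fun _ _ _ _ => leK_two_refl _⟩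
  zeroK := ⟨fun s _ => (zeroK : Two s), fun _ => continuous_const, fun _ _ _ _ => leK_two_refl _⟩
  oneK := ⟨fun s _ => (oneK : Two s), fun _ => continuous_const, fun _ _ _ _ => leK_two_refl _⟩

theorem isDPB_sHom (X : TwoSorted.{u}) : IsDPB (SHom X alterEgo) := by
  refine ⟨⟨⟨?_, ?_, ?_, ?_, ?_, ?_⟩, ⟨?_, ?_, ?_, ?_, ?_, ?_⟩,
    ?_, ?_, ?_, ?_, ?_, ?_, ?_, ?_, ?_, ?_, ?_, ?_⟩, ?_, ?_, ?_, ?_⟩ <;>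
    (try unfold Distributes) <;> intros <;>
    refine SHom.ext (funext fun s => funext fun x => ?_)
  · exact (isDPB_two s).pre.t_lattice.sup_comm _ _
  · exact (isDPB_two s).pre.t_lattice.inf_comm _ _
  · exact (isDPB_two s).pre.t_lattice.sup_assoc _ _ _
  · exact (isDPB_two s).pre.t_lattice.inf_assoc _ _ _
  · exact (isDPB_two s).pre.t_lattice.sup_inf_self _ _
  · exact (isDPB_two s).pre.t_lattice.inf_sup_self _ _
  · exact (isDPB_two s).pre.k_lattice.sup_comm _ _
  · exact (isDPB_two s).pre.k_lattice.inf_comm _ _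
  · exact (isDPB_two s).pre.k_lattice.sup_assoc _ _ _
  · exact (isDPB_two s).pre.k_lattice.inf_assoc _ _ _
  · exact (isDPB_two s).pre.k_lattice.sup_inf_self _ _
  · exact (isDPB_two s).pre.k_lattice.inf_sup_self _ _
  · exact (isDPB_two s).pre.jt_mt _ _ _
  · exact (isDPB_two s).pre.jt_jk _ _ _
  · exact (isDPB_two s).pre.jt_mk _ _ _
  · exact (isDPB_two s).pre.mt_jt _ _ _
  · exact (isDPB_two s).pre.mt_jk _ _ _
  · exact (isDPB_two s).pre.mt_mk _ _ _
  · exact (isDPB_two s).pre.jk_jt _ _ _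
  · exact (isDPB_two s).pre.jk_mt _ _ _
  · exact (isDPB_two s).pre.jk_mk _ _ _
  · exact (isDPB_two s).pre.mk_jt _ _ _
  · exact (isDPB_two s).pre.mk_mt _ _ _
  · exact (isDPB_two s).pre.mk_jk _ _ _
  · exact (isDPB_two s).zeroT_sup _
  · exact (isDPB_two s).oneT_inf _
  · exact (isDPB_two s).zeroK_sup _
  · exact (isDPB_two s).oneK_inf _

/-- The functor `E = X(-, alter ego)`, acting on morphisms by composition. -/
def functorE : DualCat.{u}ᵒᵖ ⥤ DPB.{u} where
  obj X := ⟨SHom X.unop.str alterEgo, isDPB_sHom _⟩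
  map {X Y} f :=
    { toFun := fun g => SHom.comp (show SHom Y.unop.str X.unop.str from f.unop) g
      map_supT := fun _ _ => rfl
      map_infT := fun _ _ => rfl
      map_zeroT := rfl
      map_oneT := rfl
      map_zeroK := rfl
      map_oneK := rfl }

/-- The evaluation map `e_A : A → ED(A)`, `e_A(a)(x) = x(a)`. -/
def evalAlg (A : DPB.{u}) : A ⟶ functorE.obj (op (functorD.obj (op A))) :=
  show Hom A.carrier (SHom (homStr A.carrier) alterEgo) from
  { toFun := fun a =>
      { toFun := fun s x => Hom.toFun (B := Two s) x a
        continuous_toFun := fun s =>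
          (continuous_apply a).comp (continuous_homStr_toFun A.carrier s)
        map_rel := fun _ _ _ h => h a }
    map_supT := fun a b => SHom.ext (funext fun _ => funext fun x => Hom.map_supT (B := Two _) x a b)
    map_infT := fun a b => SHom.ext (funext fun _ => funext fun x => Hom.map_infT (B := Two _) x a b)
    map_zeroT := SHom.ext (funext fun _ => funext fun x => Hom.map_zeroT (B := Two _) x)
    map_oneT := SHom.ext (funext fun _ => funext fun x => Hom.map_oneT (B := Two _) x)
    map_zeroK := SHom.ext (funext fun _ => funext fun x => Hom.map_zeroK (B := Two _) x)
    map_oneK := SHom.ext (funext fun _ => funext fun x => Hom.map_oneK (B := Two _) x) }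

/-- The evaluation map `ε_X : X → DE(X)`, `ε_X(x)(f) = f(x)`. -/
def evalSp (X : DualCat.{u}) : X ⟶ functorD.obj (op (functorE.obj (op X))) :=
  show SHom X.str (homStr (SHom X.str alterEgo)) from
  { toFun := fun s x =>
      { toFun := fun f => f.toFun s x
        map_supT := fun _ _ => rfl
        map_infT := fun _ _ => rfl
        map_zeroT := rfl
        map_oneT := rfl
        map_zeroK := rfl
        map_oneK := rfl }
    continuous_toFun := fun s => continuous_induced_rng.2 <| continuous_pi fun f =>
      f.continuous_toFun s
    map_rel := fun s x y h f => f.map_rel s x y h }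

/-! ### Natural, full and strong dualities -/

/-- The alter ego yields a (natural) duality: every `e_A` is an isomorphism. -/
def YieldsDuality : Prop := ∀ A : DPB.{u}, IsIso (evalAlg A)

/-- The alter ego yields a full duality: moreover, every `ε_X` is an isomorphism. -/
def YieldsFullDuality : Prop := YieldsDuality.{u} ∧ ∀ X : DualCat.{u}, IsIso (evalSp X)

/-- Terms in the algebraic language, with variables indexed by `S`. -/
inductive Term (S : Type u) : Type u where
  | var : S → Term S
  | supT : Term S → Term S → Term S
  | infT : Term S → Term S → Term S
  | zeroT : Term S
  | oneT : Term S
  | zeroK : Term S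
  | oneK : Term S

/-- The `S`-ary term function on `A` given by a term. -/
def Term.eval {S : Type u} {A : Type v} [Ops A] (x : S → A) : Term S → A
  | .var i => x i
  | .supT p q => Ops.supT (p.eval x) (q.eval x)
  | .infT p q => Ops.infT (p.eval x) (q.eval x)
  | .zeroT => Ops.zeroT
  | .oneT => Ops.oneT
  | .zeroK => Ops.zeroK
  | .oneK => Ops.oneK

/-- A subset `C` (given by sorts) of the power with exponent `S` is term-closed if each point `y`
outside `C` is separated from `C` by a pair of `S`-ary terms whose term functions agree on all of
`C`, in both sorts, but not at `y`. -/
def TermClosed {S : Type u} (C : ∀ s, Set ((power S).carrier s)) : Prop :=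
  ∀ (s : Sgn) (y : S → Two s), y ∉ C s → ∃ p q : Term S,
    (∀ (s' : Sgn) (x : S → Two s'), x ∈ C s' → p.eval x = q.eval x) ∧ p.eval y ≠ q.eval y

/-- The alter ego yields a strong duality: it yields a duality and every closed substructure of a
non-empty power of the alter ego is term-closed. -/
def YieldsStrongDuality : Prop :=
  YieldsDuality.{u} ∧ ∀ (S : Type u) (_ : Nonempty S) (C : ∀ s, Set ((power S).carrier s)),
    (∀ s, IsClosed (C s)) → TermClosed C

/-- The alter ego is injective in the dual category: morphisms into it extend along embeddings. -/
def AlterEgoInjective : Prop :=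
  ∀ (X Y : DualCat.{u}) (φ : SHom X.str Y.str), φ.IsClosedEmb →
    ∀ f : SHom X.str alterEgo, ∃ g : SHom Y.str alterEgo, φ.comp g = f

/-- `D` and `E` form a dual equivalence between `DPB` and the dual category, whose unit and counit
are the evaluation maps. -/
def DualEquivalence : Prop :=
  ∃ (η : 𝟭 DPB.{u}ᵒᵖ ≅ functorD ⋙ functorE.rightOp)
    (ε : functorE.rightOp ⋙ functorD ≅ 𝟭 DualCat.{u}),
    (∀ A : DPB.{u}, η.inv.app (op A) = (evalAlg A).op) ∧
    (∀ X : DualCat.{u}, ε.inv.app X = evalSp X) ∧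
    (∀ A : DPB.{u}ᵒᵖ, functorD.map (η.hom.app A) ≫ ε.hom.app (functorD.obj A) = 𝟙 _)

/-! ### Priestley spaces and bounded distributive lattices -/

/-- The category of Priestley spaces and continuous order-preserving maps. -/
structure Pries : Type (u + 1) where
  carrier : Type u
  [top : TopologicalSpace carrier]
  [order : PartialOrder carrier]
  [compact : CompactSpace carrier]
  [priestley : PriestleySpace carrier]

attribute [instance] Pries.top Pries.order Pries.compact Pries.priestley

instance : Category Pries.{u} where
  Hom P Q := P.carrier →Co Q.carrier
  id P := ContinuousOrderHom.id P.carrier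
  comp f g := ContinuousOrderHom.comp g f

/-- Each sort of `X`, with its topology and relation, is a Priestley space. -/
def SortsArePriestley (X : TwoSorted.{u}) : Prop :=
  ∀ s, ∃ _ : PartialOrder (X.carrier s), (∀ x y, X.rel s x y ↔ x ≤ y) ∧
    CompactSpace (X.carrier s) ∧ PriestleySpace (X.carrier s)

theorem compactSpace_of_mem {X : TwoSorted.{u}} (h : InIScP X) (s : Sgn) :
    CompactSpace (X.carrier s) := by
  obtain ⟨S, _, φ, hφ⟩ := h
  have : CompactSpace ((power S).carrier s) := inferInstanceAs (CompactSpace (S → Two s))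
  exact (hφ s).1.compactSpace

/-- The sort `s` of a member of `IS_cP`, as a partially ordered set. -/
abbrev sortOrder {X : TwoSorted.{u}} (h : InIScP X) (s : Sgn) : PartialOrder (X.carrier s) where
  le x y := X.rel s x y
  le_refl x := by
    obtain ⟨S, _, φ, hφ⟩ := h
    exact ((hφ s).2 _ _).2 fun _ => leK_two_refl _
  le_trans x y z := by
    obtain ⟨S, _, φ, hφ⟩ := h
    exact fun h1 h2 => ((hφ s).2 _ _).2 fun i =>
      leK_two_trans (((hφ s).2 _ _).1 h1 i) (((hφ s).2 _ _).1 h2 i)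
  le_antisymm x y := by
    obtain ⟨S, _, φ, hφ⟩ := h
    exact fun h1 h2 => (hφ s).1.injective <| funext fun i =>
      leK_two_antisymm (((hφ s).2 _ _).1 h1 i) (((hφ s).2 _ _).1 h2 i)

theorem priestleySpace_of_mem {X : TwoSorted.{u}} (h : InIScP X) (s : Sgn) :
    letI := sortOrder h s
    PriestleySpace (X.carrier s) := by
  let _ := sortOrder h s
  refine ⟨fun {x y} hxy => ?_⟩
  obtain ⟨S, _, φ, hφ⟩ := id h
  have h1 : ¬ ∀ i, leK (φ.toFun s x i : Two s) (φ.toFun s y i) :=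
    fun H => hxy (((hφ s).2 x y).2 H)
  push Not at h1
  obtain ⟨i, hi⟩ := h1
  refine ⟨{z | leK (φ.toFun s x i : Two s) (φ.toFun s z i)}, ?_, ?_, leK_two_refl _, hi⟩
  · exact (isClopen_discrete {b : Two s | leK (φ.toFun s x i : Two s) b}).preimage
      ((continuous_apply i).comp (φ.continuous_toFun s))
  · exact fun z w hzw hz => leK_two_trans hz (((hφ s).2 z w).1 hzw i)

/-- The sort `s` of an object of the dual category, as a Priestley space. -/
def sortPries (s : Sgn) (X : DualCat.{u}) : Pries.{u} :=
  letI := sortOrder X.mem s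
  haveI := compactSpace_of_mem X.mem s
  haveI := priestleySpace_of_mem X.mem s
  ⟨X.str.carrier s⟩

/-- Taking the sort `s`, as a functor. -/
def sortFunctor (s : Sgn) : DualCat.{u} ⥤ Pries.{u} where
  obj X := sortPries s X
  map {X Y} f :=
    show (sortPries s X).carrier →Co (sortPries s Y).carrier from
    { toFun := SHom.toFun f s
      monotone' := fun x y h => SHom.map_rel f s x y h
      continuous_toFun := SHom.continuous_toFun f s }

/-- The functor `F` sending a two-sorted structure to the pair of its sorts, and a morphism to the
pair of its restrictions. -/
def functorF : DualCat.{u} ⥤ Pries.{u} × Pries.{u} :=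
  (sortFunctor .plus).prod' (sortFunctor .minus)

instance (P : Type u) [TopologicalSpace P] [LE P] : DistribLattice (ClopenUpperSet P) where
  le_sup_inf := fun a b c x hx => by
    have h1 : x ∈ a ∨ x ∈ b := hx.1
    have h2 : x ∈ a ∨ x ∈ c := hx.2
    exact (or_and_left.2 ⟨h1, h2⟩ : x ∈ a ∨ x ∈ b ∧ x ∈ c)

/-- The inverse image of a clopen up-set under a continuous order-preserving map. -/
def clopenPreimage {P Q : Type u} [TopologicalSpace P] [Preorder P] [TopologicalSpace Q]
    [Preorder Q] (f : P →Co Q) (U : ClopenUpperSet Q) : ClopenUpperSet P where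
  carrier := {x | f x ∈ U}
  isClopen' := U.isClopen.preimage f.continuous_toFun
  upper' := fun _ _ hxy hx => U.upper (f.monotone' hxy) hx

/-- Priestley's functor `K`, sending a Priestley space to its lattice of clopen up-sets and acting
on morphisms by inverse image. -/
def functorK : Pries.{u}ᵒᵖ ⥤ BddDistLat.{u} where
  obj P := BddDistLat.of (ClopenUpperSet P.unop.carrier)
  map {P Q} f := BddDistLat.ofHom
    { toFun := clopenPreimage (show Q.unop.carrier →Co P.unop.carrier from f.unop)
      map_sup' := fun _ _ => rfl
      map_inf' := fun _ _ => rfl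
      map_top' := rfl
      map_bot' := rfl }

/-- The composite `(K × K) ∘ F ∘ D` from `DPB` to `D × D`, where `D` in the codomain is the
category of bounded distributive lattices. -/
def toDD : DPB.{u} ⥤ BddDistLat.{u} × BddDistLat.{u} :=
  (functorD.rightOp ⋙ (functorF ⋙ CategoryTheory.Prod.fst _ _).op ⋙ functorK).prod'
    (functorD.rightOp ⋙ (functorF ⋙ CategoryTheory.Prod.snd _ _).op ⋙ functorK)

end PreBilat

open PreBilat

namespace PreBilat

open Ops

/-! ### Basic facts on the two-element algebras -/

/-! The bounds `0_k` and `1_k` of a distributive pre-bilattice are complements of each other in the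
truth lattice. Hence a prime ideal of that lattice contains exactly one of them, and its
characteristic map is a homomorphism into `2⁺` or into `2⁻` according to which one. The prime ideal
theorem then separates points, which gives `ISP` (`IsDPB.exists_hom_ne`).

Two further facts carry the duality. The first is a Stone–Weierstrass argument (`mem_of_separates`):
on a compact space, a bounded lattice of continuous two-valued functions contains every continuous
two-valued function whose order distinctions it can make. It is applied on one sort at a time. The
complementary constants glue the sorts together, which makes `e_A` surjective; the absence of
relations between sorts does the same for extensions of morphisms, which gives injectivity. The
second is term-closure (`termClosed_of_isClosed`): a basic neighbourhood of a point missing a closed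
set involves finitely many coordinates and can be written as a pair of terms. Applied to the image
of `X` in the power indexed by `E(X)`, it makes `ε_X` surjective.

Clopen up-sets of a sort are the same as morphisms into the alter ego on that sort. This identifies
the dual category with pairs of Priestley spaces. Priestley duality itself is then read off from the
two-sorted duality, a bounded distributive lattice being a pre-bilattice whose two pairs of bounds
coincide. -/

theorem two_eq_zeroT_or_oneT {s : Sgn} : ∀ a : Two s, a = zeroT ∨ a = oneT := by
  cases s <;> decide

theorem two_zeroT_ne_oneT {s : Sgn} : (zeroT : Two s) ≠ oneT := by cases s <;> decide

theorem two_eq_of_oneT_iff {s : Sgn} {a b : Two s} (h : a = oneT ↔ b = oneT) : a = b := by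
  rcases two_eq_zeroT_or_oneT a with rfl | rfl <;> rcases two_eq_zeroT_or_oneT b with rfl | rfl
  · rfl
  · exact absurd (h.2 rfl) two_zeroT_ne_oneT
  · exact absurd (h.1 rfl) two_zeroT_ne_oneT
  · rfl

theorem two_supT_eq_oneT {s : Sgn} : ∀ {a b : Two s}, supT a b = oneT ↔ a = oneT ∨ b = oneT := by
  cases s <;> decide

theorem two_infT_eq_oneT {s : Sgn} : ∀ {a b : Two s}, infT a b = oneT ↔ a = oneT ∧ b = oneT := by
  cases s <;> decide

theorem two_supT_eq_zeroT {s : Sgn} :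
    ∀ {a b : Two s}, supT a b = zeroT ↔ a = zeroT ∧ b = zeroT := by
  cases s <;> decide

theorem two_infT_eq_zeroT {s : Sgn} :
    ∀ {a b : Two s}, infT a b = zeroT ↔ a = zeroT ∨ b = zeroT := by
  cases s <;> decide

theorem leK_plus_iff_imp : ∀ {a b : Two .plus}, leK a b ↔ (a = oneT → b = oneT) := by decide

theorem leK_minus_iff_imp : ∀ {a b : Two .minus}, leK a b ↔ (b = oneT → a = oneT) := by decide

/-! ### Hom sets into the two-element algebras separate points -/

section Algebra

variable {A : Type u} [Ops A]

/-- The truth lattice of a distributive pre-bilattice. -/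
abbrev IsDPB.distribLattice (h : IsDPB A) : DistribLattice A :=
  letI := @Lattice.mk' A ⟨supT⟩ ⟨infT⟩ h.pre.t_lattice.sup_comm h.pre.t_lattice.sup_assoc
    h.pre.t_lattice.inf_comm h.pre.t_lattice.inf_assoc h.pre.t_lattice.sup_inf_self
    h.pre.t_lattice.inf_sup_self
  DistribLattice.ofInfSupLe fun a b c => (h.pre.mt_jt a b c).le

/-- Expanding the bound law `0_k ∨_k 0_t = 0_t` in truth operations leaves `0_k ∧_t 1_k` as one of
the joinands. The next lemma expands `1_k ∧_k 1_t = 1_t`, where both joinands lie below `0_k ∨_t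
1_k`. -/
theorem IsDPB.zeroK_infT_oneK (h : IsDPB A) : infT zeroK oneK = (zeroT : A) := by
  let _ := h.distribLattice
  have hb : ∀ a : A, zeroT ≤ a := fun a => sup_eq_right.1 (h.zeroT_sup a)
  have h1 : supT (infT (infT zeroK zeroT) zeroK) (infT (supT zeroK zeroT) oneK) = (zeroT : A) :=
    h.zeroK_sup zeroT
  change (zeroK ⊓ zeroT) ⊓ zeroK ⊔ (zeroK ⊔ zeroT) ⊓ oneK = (zeroT : A) at h1
  rw [sup_eq_left.2 (hb zeroK)] at h1
  exact le_antisymm (le_sup_right.trans h1.le) (hb _)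

theorem IsDPB.zeroK_supT_oneK (h : IsDPB A) : supT zeroK oneK = (oneT : A) := by
  let _ := h.distribLattice
  have ht : ∀ a : A, a ≤ oneT := fun a => inf_eq_right.1 (h.oneT_inf a)
  have h1 : supT (infT (infT oneK oneT) oneK) (infT (supT oneK oneT) zeroK) = (oneT : A) :=
    h.oneK_inf oneT
  change (oneK ⊓ oneT) ⊓ oneK ⊔ (oneK ⊔ oneT) ⊓ zeroK = (oneT : A) at h1
  refine le_antisymm (ht _) (h1.ge.trans (sup_le ?_ ?_))
  · exact inf_le_right.trans le_sup_right
  · exact inf_le_right.trans le_sup_left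

/-- A prime ideal `J` with `b ∈ J` and `a ∉ J` gives the character `c ↦ [c ∉ J]` of the truth
lattice. Only the values at `0_k` and `1_k` decide its target. -/
theorem IsDPB.exists_hom_ne (h : IsDPB A) {a b : A} (hab : a ≠ b) :
    ∃ (s : Sgn) (x : Hom A (Two s)), x.toFun a ≠ x.toFun b := by
  let _ := h.distribLattice
  have hb : ∀ a : A, zeroT ≤ a := fun a => sup_eq_right.1 (h.zeroT_sup a)
  have ht : ∀ a : A, a ≤ oneT := fun a => inf_eq_right.1 (h.oneT_inf a)
  wlog hle : ¬ a ≤ b generalizing a b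
  · obtain ⟨s, x, hx⟩ := this hab.symm fun hba => hab (le_antisymm (not_not.1 hle) hba)
    exact ⟨s, x, hx.symm⟩
  have hd : Disjoint (Order.PFilter.principal a : Set A) (Order.Ideal.principal b : Set A) :=
    Set.disjoint_left.2 fun c (hc : a ≤ c) (hc' : c ≤ b) => hle (hc.trans hc')
  obtain ⟨J, hJ, hbJ, hdJ⟩ := DistribLattice.prime_ideal_of_disjoint_filter_ideal hd
  have ha : a ∉ J := fun hJa => Set.disjoint_left.1 hdJ (show a ≤ a from le_rfl) hJa
  have hbm : b ∈ J := hbJ (show b ≤ b from le_rfl)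
  have h0 : (zeroT : A) ∈ J := J.lower (hb b) hbm
  have h1 : (oneT : A) ∉ J := fun H => ha (J.lower (ht a) H)
  have hsup : ∀ c d : A, supT c d ∈ J ↔ c ∈ J ∧ d ∈ J := fun c d => Order.Ideal.sup_mem_iff
  have hinf : ∀ c d : A, infT c d ∈ J ↔ c ∈ J ∨ d ∈ J := fun c d =>
    ⟨hJ.mem_or_mem, fun H => H.elim (J.lower (inf_le_left : c ⊓ d ≤ c))
      (J.lower (inf_le_right : c ⊓ d ≤ d))⟩
  -- Complementarity: `J` contains at least one of `0_k`, `1_k`, and not both.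
  have hk0 := (hinf zeroK oneK).1 (by rwa [h.zeroK_infT_oneK])
  have hk1 := mt (hsup zeroK oneK).2 (by rwa [h.zeroK_supT_oneK])
  classical
  have key : ∀ (s : Sgn), decide ((zeroK : A) ∉ J) = (zeroK : Two s) →
      decide ((oneK : A) ∉ J) = (oneK : Two s) →
      ∃ x : Hom A (Two s), x.toFun a ≠ x.toFun b := fun s e0 e1 =>
    ⟨{ toFun := fun c => decide (c ∉ J)
       map_supT := fun c d => by
        change decide _ = (decide _ || decide _)
        simp only [← Bool.decide_or, hsup, not_and_or]
       map_infT := fun c d => by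
        change decide _ = (decide _ && decide _)
        simp only [← Bool.decide_and, hinf, not_or]
       map_zeroT := decide_eq_false (not_not.2 h0)
       map_oneT := decide_eq_true h1
       map_zeroK := e0
       map_oneK := e1 }, by
      change decide _ ≠ decide _
      rw [decide_eq_true ha, decide_eq_false (not_not.2 hbm)]
      decide⟩
  rcases hk0 with hk | hk
  · exact ⟨.plus, key .plus (decide_eq_false (not_not.2 hk))
      (decide_eq_true fun H => hk1 ⟨hk, H⟩)⟩
  · exact ⟨.minus, key .minus (decide_eq_true fun H => hk1 ⟨H, hk⟩)
      (decide_eq_false (not_not.2 hk))⟩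

theorem Hom.map_supK {B : Type v} [Ops B] (φ : Hom A B) (a b : A) :
    φ.toFun (supK a b) = supK (φ.toFun a) (φ.toFun b) := by
  simp only [supK, φ.map_supT, φ.map_infT, φ.map_zeroK, φ.map_oneK]

theorem Hom.map_infK {B : Type v} [Ops B] (φ : Hom A B) (a b : A) :
    φ.toFun (infK a b) = infK (φ.toFun a) (φ.toFun b) := by
  simp only [infK, φ.map_supT, φ.map_infT, φ.map_zeroK, φ.map_oneK]

/-- The laws of distributive pre-bilattices are inherited along jointly injective families of
homomorphisms. -/
theorem isDPB_of_separating {I : Type w} {B : I → Type v} [∀ i, Ops (B i)]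
    (hB : ∀ i, IsDPB (B i)) (x : ∀ i, Hom A (B i))
    (hx : ∀ a b, (∀ i, (x i).toFun a = (x i).toFun b) → a = b) : IsDPB A := by
  refine ⟨⟨⟨?_, ?_, ?_, ?_, ?_, ?_⟩, ⟨?_, ?_, ?_, ?_, ?_, ?_⟩,
    ?_, ?_, ?_, ?_, ?_, ?_, ?_, ?_, ?_, ?_, ?_, ?_⟩, ?_, ?_, ?_, ?_⟩ <;>
    (try unfold Distributes) <;> intros <;> refine hx _ _ fun i => ?_ <;>
    simp only [(x i).map_supT, (x i).map_infT, (x i).map_supK, (x i).map_infK,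
      (x i).map_zeroT, (x i).map_oneT, (x i).map_zeroK, (x i).map_oneK]
  · exact (hB i).pre.t_lattice.sup_comm _ _
  · exact (hB i).pre.t_lattice.inf_comm _ _
  · exact (hB i).pre.t_lattice.sup_assoc _ _ _
  · exact (hB i).pre.t_lattice.inf_assoc _ _ _
  · exact (hB i).pre.t_lattice.sup_inf_self _ _
  · exact (hB i).pre.t_lattice.inf_sup_self _ _
  · exact (hB i).pre.k_lattice.sup_comm _ _
  · exact (hB i).pre.k_lattice.inf_comm _ _
  · exact (hB i).pre.k_lattice.sup_assoc _ _ _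
  · exact (hB i).pre.k_lattice.inf_assoc _ _ _
  · exact (hB i).pre.k_lattice.sup_inf_self _ _
  · exact (hB i).pre.k_lattice.inf_sup_self _ _
  · exact (hB i).pre.jt_mt _ _ _
  · exact (hB i).pre.jt_jk _ _ _
  · exact (hB i).pre.jt_mk _ _ _
  · exact (hB i).pre.mt_jt _ _ _
  · exact (hB i).pre.mt_jk _ _ _
  · exact (hB i).pre.mt_mk _ _ _
  · exact (hB i).pre.jk_jt _ _ _
  · exact (hB i).pre.jk_mt _ _ _
  · exact (hB i).pre.jk_mk _ _ _
  · exact (hB i).pre.mk_jt _ _ _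
  · exact (hB i).pre.mk_mt _ _ _
  · exact (hB i).pre.mk_jk _ _ _
  · exact (hB i).zeroT_sup _
  · exact (hB i).oneT_inf _
  · exact (hB i).zeroK_sup _
  · exact (hB i).oneK_inf _

/-- The embedding evaluates at all homomorphisms into the two generators at once. Conversely, the
laws are equations, so they are checked coordinatewise. -/
theorem isDPB_iff_inISP : IsDPB A ↔ InISP A := by
  constructor
  · intro h
    refine ⟨Σ s, Hom A (Two s), Sigma.fst, ⟨fun a i => i.2.toFun a,
      fun a b => funext fun i => i.2.map_supT a b, fun a b => funext fun i => i.2.map_infT a b,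
      funext fun i => i.2.map_zeroT, funext fun i => i.2.map_oneT,
      funext fun i => i.2.map_zeroK, funext fun i => i.2.map_oneK⟩, fun a b hab => ?_⟩
    by_contra hne
    obtain ⟨s, x, hx⟩ := h.exists_hom_ne hne
    exact hx (congrFun hab ⟨s, x⟩)
  · rintro ⟨I, sgn, φ, hφ⟩
    exact isDPB_of_separating (fun i => isDPB_two (sgn i))
      (fun i => φ.comp ⟨fun f => f i, fun _ _ => rfl, fun _ _ => rfl, rfl, rfl, rfl, rfl⟩)
      fun a b hab => hφ (funext hab)

end Algebra

/-! ### A Stone-Weierstrass theorem for two-valued functions -/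

/-- The two fibres of `f` are compact. Finite meets from `L` vanish on the zero fibre while keeping
the value one at a chosen point; finite joins of these then cover the one fibre. Stating separation
through `≤_k` lets one lemma serve both sorts. -/
theorem mem_of_separates {K : Type u} [TopologicalSpace K] [CompactSpace K] {s : Sgn}
    {L : Set (K → Two s)} (hc : ∀ g ∈ L, Continuous g)
    (hsup : ∀ g ∈ L, ∀ h ∈ L, supT g h ∈ L) (hinf : ∀ g ∈ L, ∀ h ∈ L, infT g h ∈ L)
    (h0 : zeroT ∈ L) (h1 : oneT ∈ L) {f : K → Two s} (hf : Continuous f)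
    (hsep : ∀ x y, ¬ leK (f x) (f y) → ∃ g ∈ L, ¬ leK (g x) (g y)) : f ∈ L := by
  -- Separation restated in the truth order. On the minus sort `≤_k` is reversed, so `x` and `y`
  -- exchange roles.
  have hsep' : ∀ x y, f x = oneT → f y = zeroT → ∃ g ∈ L, g x = oneT ∧ g y = zeroT := by
    intro x y hx hy
    cases s with
    | plus =>
      obtain ⟨g, hg, H⟩ := hsep x y (by rw [hx, hy]; decide)
      refine ⟨g, hg, ?_⟩
      rw [leK_plus_iff_imp] at H
      push Not at H
      exact ⟨H.1, (two_eq_zeroT_or_oneT _).resolve_right H.2⟩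
    | minus =>
      obtain ⟨g, hg, H⟩ := hsep y x (by rw [hx, hy]; decide)
      refine ⟨g, hg, ?_⟩
      rw [leK_minus_iff_imp] at H
      push Not at H
      exact ⟨H.1, (two_eq_zeroT_or_oneT _).resolve_right H.2⟩
  have hcpt : ∀ b : Two s, IsCompact {x | f x = b} := fun b =>
    ((isClosed_discrete {b}).preimage hf).isCompact
  have hnhds : ∀ g ∈ L, ∀ (b : Two s) (x : K), g x = b → {z | g z = b} ∈ nhds x :=
    fun g hg b x hx => ((isOpen_discrete {b}).preimage (hc g hg)).mem_nhds hx
  -- Compactness of the zero fibre, with `x` fixed: local separators are combined by meets.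
  have step : ∀ x, f x = oneT → ∃ g ∈ L, g x = oneT ∧ ∀ y ∈ {y | f y = zeroT}, g y = zeroT := by
    intro x hx
    refine (hcpt zeroT).induction_on
      (p := fun T => ∃ g ∈ L, g x = oneT ∧ ∀ y ∈ T, g y = zeroT) ?_ ?_ ?_ ?_
    · exact ⟨oneT, h1, rfl, fun _ h => h.elim⟩
    · rintro T U hTU ⟨g, hg, hgx, hgU⟩
      exact ⟨g, hg, hgx, fun y hy => hgU y (hTU hy)⟩
    · rintro T U ⟨g, hg, hgx, hgT⟩ ⟨h, hh, hhx, hhU⟩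
      refine ⟨infT g h, hinf g hg h hh, two_infT_eq_oneT.2 ⟨hgx, hhx⟩, fun y hy => ?_⟩
      exact two_infT_eq_zeroT.2 (hy.imp (hgT y) (hhU y))
    · intro y hy
      obtain ⟨g, hg, hgx, hgy⟩ := hsep' x y hx hy
      exact ⟨_, mem_nhdsWithin_of_mem_nhds (hnhds g hg _ y hgy), g, hg, hgx, fun _ h => h⟩
  -- Compactness of the one fibre: the functions from `step` are combined by joins.
  have main : ∃ g ∈ L, (∀ x ∈ {x | f x = oneT}, g x = oneT) ∧ ∀ y, f y = zeroT → g y = zeroT := by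
    refine (hcpt oneT).induction_on
      (p := fun T => ∃ g ∈ L, (∀ x ∈ T, g x = oneT) ∧ ∀ y, f y = zeroT → g y = zeroT) ?_ ?_ ?_ ?_
    · exact ⟨zeroT, h0, fun _ h => h.elim, fun _ _ => rfl⟩
    · rintro T U hTU ⟨g, hg, hgU, hgy⟩
      exact ⟨g, hg, fun x hx => hgU x (hTU hx), hgy⟩
    · rintro T U ⟨g, hg, hgT, hgy⟩ ⟨h, hh, hhU, hhy⟩
      refine ⟨supT g h, hsup g hg h hh, fun x hx => ?_, fun y hy => ?_⟩
      · exact two_supT_eq_oneT.2 (hx.imp (hgT x) (hhU x))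
      · exact two_supT_eq_zeroT.2 ⟨hgy y hy, hhy y hy⟩
    · intro x hx
      obtain ⟨g, hg, hgx, hgy⟩ := step x hx
      exact ⟨_, mem_nhdsWithin_of_mem_nhds (hnhds g hg _ x hgx), g, hg, fun _ h => h, hgy⟩
  obtain ⟨g, hg, hg1, hg0⟩ := main
  convert hg
  funext x
  rcases two_eq_zeroT_or_oneT (f x) with hx | hx
  · rw [hx, hg0 x hx]
  · rw [hx, hg1 x hx]

/-! ### Terms -/

section Terms

variable {S : Type u}

theorem Hom.map_eval {A : Type v} {B : Type w} [Ops A] [Ops B] (h : Hom A B) (x : S → A)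
    (p : Term S) : h.toFun (p.eval x) = p.eval fun i => h.toFun (x i) := by
  induction p with
  | var i => rfl
  | supT p q hp hq => simp only [Term.eval, h.map_supT, hp, hq]
  | infT p q hp hq => simp only [Term.eval, h.map_infT, hp, hq]
  | zeroT => exact h.map_zeroT
  | oneT => exact h.map_oneT
  | zeroK => exact h.map_zeroK
  | oneK => exact h.map_oneK

/-- The meet of a finite list of variables. -/
def Term.meet (l : List S) : Term S := l.foldr (fun i p => .infT (.var i) p) .oneT

/-- The join of a finite list of variables. -/
def Term.join (l : List S) : Term S := l.foldr (fun i p => .supT (.var i) p) .zeroT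

theorem eval_meet_eq_oneT {s : Sgn} (x : S → Two s) (l : List S) :
    (Term.meet l).eval x = oneT ↔ ∀ i ∈ l, x i = oneT := by
  induction l with
  | nil => simp [Term.meet, Term.eval]
  | cons i l ih =>
    rw [List.forall_mem_cons, ← ih]
    exact two_infT_eq_oneT

theorem eval_join_eq_oneT {s : Sgn} (x : S → Two s) (l : List S) :
    (Term.join l).eval x = oneT ↔ ∃ i ∈ l, x i = oneT := by
  induction l with
  | nil => exact iff_of_false two_zeroT_ne_oneT (by simp)
  | cons i l ih =>
    rw [List.exists_mem_cons_iff, ← ih]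
    exact two_supT_eq_oneT

/-- The constant that takes the value `1_t` exactly on the sort `s`. -/
def Term.sortConst (S : Type u) : Sgn → Term S
  | .plus => .oneK
  | .minus => .zeroK

theorem eval_sortConst {s s' : Sgn} (x : S → Two s') :
    (Term.sortConst S s).eval x = oneT ↔ s = s' := by
  cases s <;> cases s' <;> simp [Term.sortConst, Term.eval] <;> decide

/-- The term `p` says "sort `s`, and every tested coordinate where `y` is one is one"; the second
term adds "and some tested coordinate where `y` is zero is one". On `C s` the addition is automatic,
since every point there differs from `y` at a tested coordinate. On the other sort both terms are
constantly `0_t`. -/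
theorem termClosed_of_isClosed {C : ∀ s, Set ((power S).carrier s)} (hC : ∀ s, IsClosed (C s)) :
    TermClosed C := by
  intro s y hy
  have hopen : IsOpen ((C s)ᶜ : Set (S → Two s)) := (hC s).isOpen_compl
  obtain ⟨T, u, hu, hsub⟩ := isOpen_pi_iff.1 hopen y hy
  have hT : ∀ x ∈ C s, ∃ i ∈ T, x i ≠ y i := by
    intro x hx
    by_contra! H
    exact hsub (fun i hi => by rw [H i hi]; exact (hu i hi).2) hx
  classical
  let l1 := T.toList.filter fun i => y i = oneT
  let l0 := T.toList.filter fun i => y i ≠ oneT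
  let p : Term S := .infT (Term.sortConst S s) (Term.meet l1)
  have hp : ∀ {s'} (x : S → Two s'), p.eval x = oneT ↔ s = s' ∧ ∀ i ∈ l1, x i = oneT := by
    intro s' x
    rw [← eval_meet_eq_oneT, ← eval_sortConst (s := s) x]
    exact two_infT_eq_oneT
  refine ⟨p, .infT p (Term.join l0), fun s' x hx => two_eq_of_oneT_iff ?_, fun h => ?_⟩
  · refine Iff.trans ?_ two_infT_eq_oneT.symm
    refine ⟨fun h => ⟨h, ?_⟩, And.left⟩
    obtain ⟨rfl, h1⟩ := (hp x).1 h
    obtain ⟨i, hi, hne⟩ := hT x hx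
    -- Since `p` is one at `x`, the points `x` and `y` agree wherever `y` is one, so the difference
    -- occurs where `y` is zero.
    have hyi : y i ≠ oneT := fun hyi =>
      hne ((h1 i (by simp [l1, hi, hyi])).trans hyi.symm)
    refine (eval_join_eq_oneT x l0).2 ⟨i, by simp [l0, hi, hyi], ?_⟩
    refine (two_eq_zeroT_or_oneT (x i)).resolve_left fun h0 => hne (h0.trans ?_)
    exact ((two_eq_zeroT_or_oneT _).resolve_right hyi).symm
  · have hpy : p.eval y = oneT := (hp y).2 ⟨rfl, by simp [l1]⟩
    have := (two_infT_eq_oneT.1 (h.symm.trans hpy)).2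
    obtain ⟨i, hi, hi1⟩ := (eval_join_eq_oneT y l0).1 this
    simp [l0, hi1] at hi

end Terms

/-! ### Morphisms into the alter ego and clopen up-sets -/

theorem leK_two_iff {s : Sgn} : ∀ {a b : Two s}, leK a b ↔ (a = oneK → b = oneK) := by
  cases s <;> decide

theorem two_zeroK_ne_oneK {s : Sgn} : (zeroK : Two s) ≠ oneK := by cases s <;> decide

open Classical in
/-- The morphism into the alter ego that takes the value `1_k` exactly on the given clopen
up-sets. -/
noncomputable def indicator {X : TwoSorted.{u}} (U : ∀ s, Set (X.carrier s))
    (hU : ∀ s, IsClopen (U s)) (hup : ∀ s x y, X.rel s x y → x ∈ U s → y ∈ U s) :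
    SHom X alterEgo where
  toFun s x := (if x ∈ U s then oneK else zeroK : Two s)
  continuous_toFun s := continuous_const.if
    (fun a ha => by
      have ha' : a ∈ frontier (U s) := ha
      rw [(hU s).frontier_eq] at ha'
      exact ha'.elim) continuous_const
  map_rel s x y h := by
    refine leK_two_iff.2 fun hx => ?_
    by_cases hxU : x ∈ U s
    · exact if_pos (hup s x y h hxU)
    · rw [if_neg hxU] at hx
      exact absurd hx two_zeroK_ne_oneK

open Classical in
theorem indicator_eq_oneK_iff {X : TwoSorted.{u}} {U : ∀ s, Set (X.carrier s)}
    {hU : ∀ s, IsClopen (U s)} {hup : ∀ s x y, X.rel s x y → x ∈ U s → y ∈ U s} {s : Sgn}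
    {x : X.carrier s} : (indicator U hU hup).toFun s x = (oneK : Two s) ↔ x ∈ U s := by
  change (if x ∈ U s then oneK else zeroK : Two s) = oneK ↔ x ∈ U s
  split_ifs with h
  · exact iff_of_true rfl h
  · exact iff_of_false two_zeroK_ne_oneK h

/-- No relation links the sorts, so the up-set may be completed by the empty set on the other sort.
-/
theorem exists_sHom_eq_oneK_iff {X : TwoSorted.{u}} {s : Sgn} {U : Set (X.carrier s)}
    (hU : IsClopen U) (hup : ∀ x y, X.rel s x y → x ∈ U → y ∈ U) :
    ∃ f : SHom X alterEgo, ∀ x, f.toFun s x = (oneK : Two s) ↔ x ∈ U := by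
  let V : ∀ s', Set (X.carrier s') := Function.update (fun _ => ∅) s U
  have hV : V s = U := Function.update_self ..
  have hV' : ∀ s', s' ≠ s → V s' = ∅ := fun s' h => Function.update_of_ne h ..
  have h1 : ∀ s', IsClopen (V s') := fun s' => by
    by_cases h : s' = s
    · subst h; rwa [hV]
    · rw [hV' s' h]; exact isClopen_empty
  have h2 : ∀ s' x y, X.rel s' x y → x ∈ V s' → y ∈ V s' := fun s' => by
    by_cases h : s' = s
    · subst h; rwa [hV]
    · rw [hV' s' h]; exact fun _ _ _ h => h
  exact ⟨indicator V h1 h2, fun x => by rw [indicator_eq_oneK_iff, hV]⟩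

/-- The evaluation map into the power whose exponent consists of all morphisms into the
alter ego. -/
def evalPower (X : TwoSorted.{u}) : SHom X (power (SHom X alterEgo)) where
  toFun s x := fun f => f.toFun s x
  continuous_toFun s := continuous_pi fun f => f.continuous_toFun s
  map_rel s x y h := fun f => f.map_rel s x y h

theorem SortsArePriestley.exists_sHom_not_leK {X : TwoSorted.{u}} (h : SortsArePriestley X)
    {s : Sgn} {x y : X.carrier s} (hxy : ¬ X.rel s x y) :
    ∃ f : SHom X alterEgo, ¬ leK (A := Two s) (f.toFun s x) (f.toFun s y) := by
  obtain ⟨_, hle, _, _⟩ := h s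
  rw [hle] at hxy
  obtain ⟨U, hU, hup, hx, hy⟩ := exists_isClopen_upper_of_not_le hxy
  obtain ⟨f, hf⟩ := exists_sHom_eq_oneK_iff hU fun x y h => hup ((hle x y).1 h)
  exact ⟨f, fun H => hy ((hf y).1 (leK_two_iff.1 H ((hf x).2 hx)))⟩

/-- Priestley separation makes evaluation reflect the relation, antisymmetry then makes it
injective, and a continuous injection from a compact space to a Hausdorff space is a closed
embedding. -/
theorem SortsArePriestley.isClosedEmb_evalPower {X : TwoSorted.{u}} (h : SortsArePriestley X) :
    (evalPower X).IsClosedEmb := by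
  intro s
  have hrel : ∀ x y, X.rel s x y ↔
      (power (SHom X alterEgo)).rel s ((evalPower X).toFun s x) ((evalPower X).toFun s y) := by
    refine fun x y => ⟨(evalPower X).map_rel s x y, fun H => ?_⟩
    by_contra hxy
    obtain ⟨f, hf⟩ := h.exists_sHom_not_leK hxy
    exact hf (H f)
  refine ⟨?_, hrel⟩
  obtain ⟨_, hle, _, _⟩ := h s
  have : T2Space ((power (SHom X alterEgo)).carrier s) :=
    inferInstanceAs (T2Space (SHom X alterEgo → Two s))
  refine ((evalPower X).continuous_toFun s).isClosedEmbedding fun x y hxy => le_antisymm ?_ ?_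
  · exact (hle x y).1 ((hrel x y).2 fun f => (congrFun hxy f) ▸ leK_two_refl _)
  · exact (hle y x).1 ((hrel y x).2 fun f => (congrFun hxy f) ▸ leK_two_refl _)

theorem inIScP_iff_sortsArePriestley {X : TwoSorted.{u}} : InIScP X ↔ SortsArePriestley X :=
  ⟨fun h s => ⟨sortOrder h s, fun _ _ => Iff.rfl, compactSpace_of_mem h s,
    priestleySpace_of_mem h s⟩,
  fun h => ⟨SHom X alterEgo, ⟨zeroT⟩, evalPower X, h.isClosedEmb_evalPower⟩⟩

/-! ### The evaluation maps are isomorphisms -/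

theorem sHom_mem_of_separates {X : TwoSorted.{u}} {s : Sgn} [CompactSpace (X.carrier s)]
    (f : SHom X alterEgo) {L : Set (X.carrier s → Two s)} (hc : ∀ g ∈ L, Continuous g)
    (hsup : ∀ g ∈ L, ∀ h ∈ L, supT g h ∈ L) (hinf : ∀ g ∈ L, ∀ h ∈ L, infT g h ∈ L)
    (h0 : zeroT ∈ L) (h1 : oneT ∈ L)
    (hsep : ∀ x y, ¬ X.rel s x y → ∃ g ∈ L, ¬ leK (g x) (g y)) :
    (fun x => f.toFun s x) ∈ L :=
  mem_of_separates hc hsup hinf h0 h1 (f.continuous_toFun s) fun x y hxy =>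
    hsep x y fun h => hxy (f.map_rel s x y h)

theorem evalAlg_injective (A : DPB.{u}) : Function.Injective (Hom.toFun (evalAlg A)) := by
  intro a b hab
  by_contra hne
  obtain ⟨s, x, hx⟩ := A.isDPB.exists_hom_ne hne
  exact hx (congrFun (congrFun (congrArg SHom.toFun hab) s) x)

theorem evalAlg_surjective (A : DPB.{u}) : Function.Surjective (Hom.toFun (evalAlg A)) := by
  intro (f : SHom (homStr A.carrier) alterEgo)
  change ∃ a, _ = f
  have key : ∀ s, ∃ a : A.carrier, ∀ x : Hom A.carrier (Two s), x.toFun a = f.toFun s x := by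
    intro s
    have : CompactSpace ((homStr A.carrier).carrier s) := compactSpace_of_mem (homStr_mem _) s
    suffices h : (fun x => f.toFun s x) ∈
        Set.range fun a (x : Hom A.carrier (Two s)) => x.toFun a by
      obtain ⟨a, ha⟩ := h
      exact ⟨a, congrFun ha⟩
    refine sHom_mem_of_separates f ?_ ?_ ?_ ?_ ?_ ?_
    · rintro _ ⟨a, rfl⟩
      exact (continuous_apply a).comp (continuous_homStr_toFun A.carrier s)
    · rintro _ ⟨a, rfl⟩ _ ⟨b, rfl⟩
      exact ⟨supT a b, funext fun x => x.map_supT a b⟩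
    · rintro _ ⟨a, rfl⟩ _ ⟨b, rfl⟩
      exact ⟨infT a b, funext fun x => x.map_infT a b⟩
    · exact ⟨zeroT, funext fun x => x.map_zeroT⟩
    · exact ⟨oneT, funext fun x => x.map_oneT⟩
    · intro x y hxy
      obtain ⟨a, ha⟩ := not_forall.1 hxy
      exact ⟨_, ⟨a, rfl⟩, ha⟩
  obtain ⟨a, ha⟩ := key .plus
  obtain ⟨b, hb⟩ := key .minus
  -- Gluing: `1_k` equals `1_t` on the plus sort and `0_t` on the minus sort, and `0_k` the reverse,
  -- so this combination selects `a` on one sort and `b` on the other.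
  have hp : ∀ c d : Two .plus, supT (infT c oneK) (infT d zeroK) = c := by decide
  have hm : ∀ c d : Two .minus, supT (infT c oneK) (infT d zeroK) = d := by decide
  refine ⟨supT (infT a oneK) (infT b zeroK), SHom.ext (funext fun s => funext fun (x : Hom A.carrier (Two s)) => ?_)⟩
  change x.toFun _ = f.toFun s x
  rw [Hom.map_supT, Hom.map_infT, Hom.map_infT, Hom.map_zeroK, Hom.map_oneK]
  cases s with
  | plus => exact (hp _ _).trans (ha x)
  | minus => exact (hm _ _).trans (hb x)

theorem DPB.isIso_of_bijective {A B : DPB.{u}} (f : A ⟶ B)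
    (hf : Function.Bijective (Hom.toFun f)) : IsIso f := by
  let e := Equiv.ofBijective _ hf
  have he : ∀ b, Hom.toFun f (e.symm b) = b := e.apply_symm_apply
  let g : Hom B.carrier A.carrier :=
    { toFun := e.symm
      map_supT := fun a b => hf.1 <| by rw [Hom.map_supT, he, he, he]
      map_infT := fun a b => hf.1 <| by rw [Hom.map_infT, he, he, he]
      map_zeroT := hf.1 <| by rw [Hom.map_zeroT, he]
      map_oneT := hf.1 <| by rw [Hom.map_oneT, he]
      map_zeroK := hf.1 <| by rw [Hom.map_zeroK, he]
      map_oneK := hf.1 <| by rw [Hom.map_oneK, he] }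
  exact ⟨g, Hom.ext (funext e.symm_apply_apply), Hom.ext (funext he)⟩

theorem yieldsDuality : YieldsDuality.{u} := fun A =>
  DPB.isIso_of_bijective _ ⟨evalAlg_injective A, evalAlg_surjective A⟩

/-- The image of `X` in the power indexed by `E(X)` is closed, so a homomorphism `h` outside it is
separated by two terms. At the tautological tuple listing all elements of `E(X)`, these terms yield
the same morphism, because they agree at every point of `X`. Applying `h` contradicts the
separation. -/
theorem evalSp_surjective (X : DualCat.{u}) (s : Sgn) :
    Function.Surjective (SHom.toFun (evalSp X) s) := by
  intro (h : Hom (SHom X.str alterEgo) (Two s))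
  have hemb := (inIScP_iff_sortsArePriestley.1 X.mem).isClosedEmb_evalPower
  suffices H : h.toFun ∈ Set.range ((evalPower X.str).toFun s) by
    obtain ⟨x, hx⟩ := H
    exact ⟨x, Hom.ext hx⟩
  by_contra hh
  obtain ⟨p, q, hpq, hne⟩ := termClosed_of_isClosed
    (C := fun s => Set.range ((evalPower X.str).toFun s)) (fun s => (hemb s).1.isClosed_range)
    s h.toFun hh
  have heval : ∀ r : Term (SHom X.str alterEgo), h.toFun (r.eval fun f => f) = r.eval h.toFun :=
    fun r => h.map_eval _ r
  rw [← heval, ← heval] at hne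
  refine hne (congrArg _ (SHom.ext (funext fun s' => funext fun x => ?_)))
  have hev : ∀ r : Term (SHom X.str alterEgo), (r.eval fun f => f).toFun s' x =
      r.eval (A := Two s') ((evalPower X.str).toFun s' x) := fun r =>
    Hom.map_eval (Hom.mk (B := Two s') (fun f : SHom X.str alterEgo => f.toFun s' x)
      (fun _ _ => rfl) (fun _ _ => rfl) rfl rfl rfl rfl) _ r
  exact (hev p).trans ((hpq s' _ ⟨x, rfl⟩).trans (hev q).symm)

/-- Reflecting the order forces injectivity by antisymmetry; the inverse is continuous because the
sorts are compact and Hausdorff. -/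
theorem DualCat.isIso_of_surjective {X Y : DualCat.{u}} (f : X ⟶ Y)
    (hf : ∀ s, Function.Surjective (SHom.toFun f s))
    (hrel : ∀ s x y, Y.str.rel s (SHom.toFun f s x) (SHom.toFun f s y) → X.str.rel s x y) :
    IsIso f := by
  have hb : ∀ s, Function.Bijective (SHom.toFun f s) := fun s => by
    let _ := sortOrder X.mem s
    let _ := sortOrder Y.mem s
    refine ⟨fun x y hxy => le_antisymm (hrel s x y ?_) (hrel s y x ?_), hf s⟩
    · exact (show SHom.toFun f s x ≤ SHom.toFun f s y from hxy.le)
    · exact (show SHom.toFun f s y ≤ SHom.toFun f s x from hxy.ge)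
  let e := fun s => Equiv.ofBijective _ (hb s)
  have he : ∀ s y, SHom.toFun f s ((e s).symm y) = y := fun s => (e s).apply_symm_apply
  let g : SHom Y.str X.str :=
    { toFun := fun s => (e s).symm
      continuous_toFun := fun s => by
        let _ := sortOrder Y.mem s
        have := compactSpace_of_mem X.mem s
        have := priestleySpace_of_mem Y.mem s
        exact Continuous.continuous_symm_of_equiv_compact_to_t2 (f := e s)
          (SHom.continuous_toFun f s)
      map_rel := fun s x y h => hrel s _ _ (by rwa [he, he]) }
  exact ⟨g, SHom.ext (funext fun s => funext (e s).symm_apply_apply),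
    SHom.ext (funext fun s => funext (he s))⟩

theorem yieldsFullDuality : YieldsFullDuality.{u} :=
  ⟨yieldsDuality, fun X => DualCat.isIso_of_surjective _ (evalSp_surjective X) fun s x y h =>
    (((inIScP_iff_sortsArePriestley.1 X.mem).isClosedEmb_evalPower s).2 x y).2 h⟩

theorem yieldsStrongDuality : YieldsStrongDuality.{u} :=
  ⟨yieldsDuality, fun _ _ _ hC => termClosed_of_isClosed hC⟩

/-! ### Injectivity of the alter ego and the dual equivalence -/

theorem alterEgoInjective : AlterEgoInjective.{u} := by
  intro X Y φ hφ f
  have key : ∀ s, ∃ u : SHom Y.str alterEgo, ∀ x, u.toFun s (φ.toFun s x) = f.toFun s x := by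
    intro s
    have := compactSpace_of_mem X.mem s
    -- The restrictions to `X` of morphisms on `Y` form a bounded lattice of functions. They
    -- separate enough because `φ` reflects the relation and the sorts of `Y` are Priestley spaces.
    suffices h : (fun x => f.toFun s x) ∈
        Set.range fun (u : SHom Y.str alterEgo) x => u.toFun s (φ.toFun s x) by
      obtain ⟨u, hu⟩ := h
      exact ⟨u, congrFun hu⟩
    refine sHom_mem_of_separates f ?_ ?_ ?_ ?_ ?_ ?_
    · rintro _ ⟨u, rfl⟩
      exact (u.continuous_toFun s).comp (φ.continuous_toFun s)
    · rintro _ ⟨u, rfl⟩ _ ⟨v, rfl⟩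
      exact ⟨supT u v, rfl⟩
    · rintro _ ⟨u, rfl⟩ _ ⟨v, rfl⟩
      exact ⟨infT u v, rfl⟩
    · exact ⟨zeroT, rfl⟩
    · exact ⟨oneT, rfl⟩
    · intro x y hxy
      obtain ⟨u, hu⟩ := (inIScP_iff_sortsArePriestley.1 Y.mem).exists_sHom_not_leK
        (mt ((hφ s).2 x y).2 hxy)
      exact ⟨_, ⟨u, rfl⟩, hu⟩
  choose u hu using key
  exact ⟨⟨fun s => (u s).toFun s, fun s => (u s).continuous_toFun s, fun s => (u s).map_rel s⟩,
    SHom.ext (funext fun s => funext (hu s))⟩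

theorem dualEquivalence : DualEquivalence.{u} := by
  have hA : ∀ A : DPB.{u}, IsIso (evalAlg A) := yieldsDuality
  have hX : ∀ X : DualCat.{u}, IsIso (evalSp X) := yieldsFullDuality.2
  let η : functorD ⋙ functorE.rightOp ≅ 𝟭 DPB.{u}ᵒᵖ :=
    NatIso.ofComponents (fun A => (asIso (evalAlg A.unop)).op) fun _ => rfl
  let ε : 𝟭 DualCat.{u} ≅ functorE.rightOp ⋙ functorD :=
    NatIso.ofComponents (fun X => @asIso _ _ X _ (evalSp X) (hX X)) fun _ => rfl
  refine ⟨η.symm, ε.symm, fun _ => rfl, fun _ => rfl, fun A => ?_⟩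
  -- The triangle identity for the evaluation maps holds by computation; the required one, for their
  -- inverses, follows by cancelling isomorphisms.
  have h : ε.hom.app (functorD.obj A) ≫ functorD.map (η.hom.app A) = 𝟙 _ := rfl
  change functorD.map (η.inv.app A) ≫ ε.inv.app (functorD.obj A) = 𝟙 _
  rw [← cancel_epi (functorD.map (η.hom.app A)), ← cancel_epi (ε.hom.app (functorD.obj A)),
    ← Functor.map_comp_assoc, Iso.hom_inv_id_app, reassoc_of% h]
  simp

theorem functorD_isEquivalence : (functorD.{u}).IsEquivalence := by
  obtain ⟨η, ε, -, -, h⟩ := dualEquivalence.{u}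
  exact (Equivalence.mk' functorD functorE.rightOp η ε h).isEquivalence_functor

/-! ### Pairs of Priestley spaces -/

/-- The pair `(P, Q)` as a family indexed by the labels. -/
def pairFamily (P Q : Pries.{u}) : Sgn → Pries.{u}
  | .plus => P
  | .minus => Q

/-- The two-sorted structure with sorts `P` and `Q`. -/
def pairStr (P Q : Pries.{u}) : TwoSorted.{u} where
  carrier s := (pairFamily P Q s).carrier
  rel _ x y := x ≤ y

theorem sortsArePriestley_pairStr (P Q : Pries.{u}) : SortsArePriestley (pairStr P Q) := fun s =>
  ⟨(pairFamily P Q s).order, fun _ _ => Iff.rfl, (pairFamily P Q s).compact,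
    (pairFamily P Q s).priestley⟩

/-- The object of the dual category with sorts `P` and `Q`. -/
def pairObj (P Q : Pries.{u}) : DualCat.{u} :=
  ⟨pairStr P Q, inIScP_iff_sortsArePriestley.2 (sortsArePriestley_pairStr P Q)⟩

/-- Each sort of `pairObj P Q` is the given Priestley space. -/
def sortPairIso (P Q : Pries.{u}) (s : Sgn) :
    (sortFunctor s).obj (pairObj P Q) ≅ pairFamily P Q s where
  hom := show (sortPries s (pairObj P Q)).carrier →Co (pairFamily P Q s).carrier from
    { toFun := fun x => x, monotone' := fun _ _ h => h, continuous_toFun := continuous_id }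
  inv := show (pairFamily P Q s).carrier →Co (sortPries s (pairObj P Q)).carrier from
    { toFun := fun x => x, monotone' := fun _ _ h => h, continuous_toFun := continuous_id }

theorem functorF_isEquivalence : (functorF.{u}).IsEquivalence where
  faithful := ⟨fun {X Y} f g h => SHom.ext (funext fun s => funext fun x => by
    cases s with
    | plus => exact DFunLike.congr_fun (F := (sortPries .plus X).carrier →Co
        (sortPries .plus Y).carrier) (congrArg Prod.fst h) x
    | minus => exact DFunLike.congr_fun (F := (sortPries .minus X).carrier →Co
        (sortPries .minus Y).carrier) (congrArg Prod.snd h) x)⟩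
  full := ⟨fun {X Y} f => by
    let g : ∀ s, (sortPries s X).carrier →Co (sortPries s Y).carrier := fun s =>
      match s with
      | .plus => f.1
      | .minus => f.2
    exact ⟨(⟨fun s => g s, fun s => (g s).continuous_toFun, fun s x y h => (g s).monotone' h⟩ :
      SHom X.str Y.str), rfl⟩⟩
  essSurj := ⟨fun ⟨P, Q⟩ => ⟨pairObj P Q,
    ⟨Iso.prod (sortPairIso P Q .plus) (sortPairIso P Q .minus)⟩⟩⟩

/-! ### Priestley duality -/

/-- Distinct points of a Priestley space are separated by a clopen up-set, in one direction or the
other. -/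
theorem functorK_faithful : (functorK.{u}).Faithful := ⟨fun {P Q} f g h => by
  refine Quiver.Hom.unop_inj (ContinuousOrderHom.ext fun x => ?_)
  have H : ∀ U : ClopenUpperSet P.unop.carrier,
      (show Q.unop.carrier →Co P.unop.carrier from f.unop) x ∈ U ↔
        (show Q.unop.carrier →Co P.unop.carrier from g.unop) x ∈ U := fun U =>
    iff_of_eq (congrArg (fun V : ClopenUpperSet Q.unop.carrier => x ∈ V)
      (DFunLike.congr_fun (congrArg BddDistLat.Hom.hom h) U))
  by_contra hne
  obtain ⟨U, hU, hup, hx, hy⟩ | ⟨U, hU, hup, hx, hy⟩ :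
      (∃ U, IsClopen U ∧ IsUpperSet U ∧
        (show Q.unop.carrier →Co P.unop.carrier from f.unop) x ∈ U ∧
        (show Q.unop.carrier →Co P.unop.carrier from g.unop) x ∉ U) ∨
      (∃ U, IsClopen U ∧ IsUpperSet U ∧
        (show Q.unop.carrier →Co P.unop.carrier from g.unop) x ∈ U ∧
        (show Q.unop.carrier →Co P.unop.carrier from f.unop) x ∉ U) :=
    (Ne.not_le_or_not_ge hne).imp exists_isClopen_upper_of_not_le exists_isClopen_upper_of_not_le
  · exact hy ((H ⟨⟨U, hU⟩, hup⟩).1 hx)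
  · exact hy ((H ⟨⟨U, hU⟩, hup⟩).2 hx)⟩

/-- The clopen up-set of a morphism into the alter ego, in the positive sort. -/
def plusUpperSet {P Q : Pries.{u}} (g : SHom (pairStr P Q) alterEgo) :
    ClopenUpperSet P.carrier where
  carrier := {z | g.toFun .plus z = (oneT : Two .plus)}
  isClopen' := (isClopen_discrete {(oneT : Two .plus)}).preimage (g.continuous_toFun .plus)
  upper' := fun z w h => leK_plus_iff_imp.1 (g.map_rel .plus z w h)

theorem plusUpperSet_surjective {P Q : Pries.{u}} :
    Function.Surjective (plusUpperSet (P := P) (Q := Q)) := by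
  intro U
  obtain ⟨g, hg⟩ := exists_sHom_eq_oneK_iff (X := pairStr P Q) (s := .plus) U.isClopen
    fun _ _ h => U.upper h
  exact ⟨g, SetLike.ext hg⟩

/-- Every bounded lattice homomorphism from the clopen up-sets of `P` into the two-element lattice
is the evaluation at a point of `P`. -/
theorem exists_point_of_hom {P : Pries.{u}} (χ : ClopenUpperSet P.carrier → Prop)
    (hsup : ∀ U V, χ (U ⊔ V) ↔ χ U ∨ χ V) (hinf : ∀ U V, χ (U ⊓ V) ↔ χ U ∧ χ V)
    (htop : χ ⊤) (hbot : ¬ χ ⊥) : ∃ y : P.carrier, ∀ U, y ∈ U ↔ χ U := by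
  classical
  have h0 : plusUpperSet (zeroT : SHom (pairStr P P) alterEgo) = ⊥ :=
    SetLike.ext fun z => iff_of_false (two_zeroT_ne_oneT (s := .plus)) fun h => h
  have h1 : plusUpperSet (oneT : SHom (pairStr P P) alterEgo) = ⊤ :=
    SetLike.ext fun z => iff_of_true rfl trivial
  rw [← h0] at hbot
  rw [← h1] at htop
  -- Pulling `χ` back to `E` of the pair `(P, P)` gives a homomorphism into `2⁺`, hence a point by
  -- fullness of the two-sorted duality. The second sort plays no role; `P` is merely a convenient
  -- filler.
  let h : Hom (SHom (pairStr P P) alterEgo) (Two .plus) :=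
    { toFun := fun g => (decide (χ (plusUpperSet g)) : Bool)
      map_supT := fun f g => by
        have : plusUpperSet (supT f g) = plusUpperSet f ⊔ plusUpperSet g :=
          SetLike.ext fun z => two_supT_eq_oneT (s := .plus)
        change decide _ = (decide _ || decide _)
        simp only [this, hsup, Bool.decide_or]
      map_infT := fun f g => by
        have : plusUpperSet (infT f g) = plusUpperSet f ⊓ plusUpperSet g :=
          SetLike.ext fun z => two_infT_eq_oneT (s := .plus)
        change decide _ = (decide _ && decide _)
        simp only [this, hinf, Bool.decide_and]
      map_zeroT := decide_eq_false hbot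
      map_oneT := decide_eq_true htop
      map_zeroK := decide_eq_false hbot
      map_oneK := decide_eq_true htop }
  obtain ⟨y, hy⟩ := evalSp_surjective (pairObj P P) .plus h
  refine ⟨y, fun U => ?_⟩
  obtain ⟨g, rfl⟩ := plusUpperSet_surjective (Q := P) U
  have hyg : g.toFun .plus y = h.toFun g := congrFun (congrArg Hom.toFun hy) g
  change g.toFun .plus y = (oneT : Two .plus) ↔ _
  rw [hyg]
  exact decide_eq_true_iff

theorem functorK_full : (functorK.{u}).Full := ⟨fun {P Q} f => by
  let φ : BoundedLatticeHom (ClopenUpperSet P.unop.carrier) (ClopenUpperSet Q.unop.carrier) :=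
    BddDistLat.Hom.hom f
  have key : ∀ x : Q.unop.carrier, ∃ y : P.unop.carrier, ∀ U, y ∈ U ↔ x ∈ φ U := by
    refine fun x => exists_point_of_hom (fun U => x ∈ φ U) ?_ ?_ ?_ ?_
    · intro U V
      rw [map_sup]
      exact Iff.rfl
    · intro U V
      rw [map_inf]
      exact Iff.rfl
    · rw [map_top]
      exact trivial
    · rw [map_bot]
      exact fun h => h
  choose g hg using key
  have hcont : Continuous g := by
    -- Continuity is tested after embedding `P` in a power of the two-element space: each coordinate
    -- of `g` is the characteristic function of the clopen set `φ U` for a clopen up-set `U`.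
    have hemb := ((sortsArePriestley_pairStr P.unop P.unop).isClosedEmb_evalPower .plus).1
    refine hemb.isInducing.continuous_iff.2 (continuous_pi fun u => ?_)
    have hclopen : IsClopen {x | u.toFun .plus (g x) = (oneT : Two .plus)} := by
      have : {x | u.toFun .plus (g x) = (oneT : Two .plus)} = (φ (plusUpperSet u) : Set _) :=
        Set.ext fun x => hg x (plusUpperSet u)
      rw [this]
      exact (φ (plusUpperSet u)).isClopen
    refine continuous_discrete_rng.2 fun (b : Two .plus) => ?_
    rcases two_eq_zeroT_or_oneT b with rfl | rfl
    · convert hclopen.compl.isOpen using 1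
      ext x
      refine ⟨fun (h : _ = _) h' => two_zeroT_ne_oneT (h.symm.trans h'), fun h => ?_⟩
      exact (two_eq_zeroT_or_oneT _).resolve_right h
    · exact hclopen.isOpen
  refine ⟨Quiver.Hom.op (show Q.unop.carrier →Co P.unop.carrier from
    { toFun := g
      monotone' := fun x x' hxx' => ?_
      continuous_toFun := hcont }), ?_⟩
  · by_contra hle
    obtain ⟨U, hU, hup, hx, hx'⟩ := exists_isClopen_upper_of_not_le hle
    exact hx' ((hg x' ⟨⟨U, hU⟩, hup⟩).2 ((φ _).upper hxx' ((hg x ⟨⟨U, hU⟩, hup⟩).1 hx)))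
  · exact BddDistLat.hom_ext (BoundedLatticeHom.ext fun U =>
      SetLike.ext (A := ClopenUpperSet Q.unop.carrier) fun x => hg x U)⟩

/-- A bounded distributive lattice as a distributive pre-bilattice with `0_k = 0_t` and
`1_k = 1_t`. -/
abbrev latticeOps (α : Type u) [DistribLattice α] [BoundedOrder α] : Ops α where
  supT := (· ⊔ ·)
  infT := (· ⊓ ·)
  zeroT := ⊥
  oneT := ⊤
  zeroK := ⊥
  oneK := ⊤

theorem isDPB_latticeOps (α : Type u) [DistribLattice α] [BoundedOrder α] :
    @IsDPB α (latticeOps α) := by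
  let _ := latticeOps α
  have hs : ∀ a b : α, supK a b = a ⊔ b := fun a b =>
    (show a ⊓ b ⊓ ⊥ ⊔ (a ⊔ b) ⊓ ⊤ = a ⊔ b by simp)
  have hi : ∀ a b : α, infK a b = a ⊓ b := fun a b =>
    (show a ⊓ b ⊓ ⊤ ⊔ (a ⊔ b) ⊓ ⊥ = a ⊓ b by simp)
  have hs' : (supK : α → α → α) = (· ⊔ ·) := funext fun a => funext (hs a)
  have hi' : (infK : α → α → α) = (· ⊓ ·) := funext fun a => funext (hi a)
  have hl : IsLatticePair (A := α) (· ⊔ ·) (· ⊓ ·) :=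
    ⟨sup_comm, inf_comm, sup_assoc, inf_assoc, fun _ _ => sup_inf_self, fun _ _ => inf_sup_self⟩
  have hss : Distributes (A := α) (· ⊔ ·) (· ⊔ ·) := sup_sup_distrib_left
  have hii : Distributes (A := α) (· ⊓ ·) (· ⊓ ·) := inf_inf_distrib_left
  have hsi : Distributes (A := α) (· ⊔ ·) (· ⊓ ·) := sup_inf_left
  have his : Distributes (A := α) (· ⊓ ·) (· ⊔ ·) := inf_sup_left
  refine ⟨?_, fun a => bot_sup_eq a, fun a => top_inf_eq a, fun a => ?_, fun a => ?_⟩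
  · rw [hs', hi']
    exact ⟨hl, hl, hsi, hss, hsi, his, his, hii, hss, hsi, hsi, his, hii, his⟩
  · exact (hs _ _).trans (bot_sup_eq a)
  · exact (hi _ _).trans (top_inf_eq a)

/-- A bounded distributive lattice is isomorphic to the lattice of clopen up-sets of its
Priestley dual. -/
theorem functorK_essSurj : (functorK.{u}).EssSurj := ⟨fun L => by
  let _ := latticeOps L
  let A : DPB.{u} := ⟨L, isDPB_latticeOps L⟩
  let P : Pries.{u} := sortPries .plus (functorD.obj (op A))
  -- In `A` the constants `0_t` and `0_k` coincide, but in `2⁻` they differ: the minus sort of the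
  -- dual is empty.
  have hminus : Hom A.carrier (Two .minus) → False := fun x =>
    two_zeroT_ne_oneT (x.map_zeroT.symm.trans x.map_zeroK)
  let e : A.carrier → ClopenUpperSet P.carrier := fun a =>
    { carrier := {x : Hom A.carrier (Two .plus) | x.toFun a = oneT}
      isClopen' := (isClopen_discrete {(oneT : Two .plus)}).preimage
        ((continuous_apply a).comp (continuous_homStr_toFun A.carrier .plus))
      upper' := fun (x y : Hom A.carrier (Two .plus)) h => leK_plus_iff_imp.1 (h a) }
  have he_inj : Function.Injective e := by
    intro a b hab
    by_contra hne
    obtain ⟨s, x, hx⟩ := A.isDPB.exists_hom_ne hne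
    cases s with
    | plus => exact hx (two_eq_of_oneT_iff (iff_of_eq (congrArg (x ∈ ·) hab)))
    | minus => exact hminus x
  have he_surj : Function.Surjective e := by
    intro U
    -- A clopen up-set is a morphism into the alter ego, hence evaluation at an element of `L` by
    -- the duality for `A`.
    obtain ⟨f, hf⟩ := exists_sHom_eq_oneK_iff (X := homStr A.carrier) (s := .plus) U.isClopen
      fun _ _ h => U.upper h
    obtain ⟨a, rfl⟩ := evalAlg_surjective A f
    exact ⟨a, SetLike.ext hf⟩
  have he_sup : ∀ a b : L, e (a ⊔ b) = e a ⊔ e b := fun a b =>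
    SetLike.ext fun (x : Hom A.carrier (Two .plus)) => by
      change x.toFun (supT (A := A.carrier) a b) = oneT ↔ x.toFun a = oneT ∨ x.toFun b = oneT
      rw [x.map_supT, two_supT_eq_oneT]
  have he_le : ∀ a b : L, e a ≤ e b ↔ a ≤ b := fun a b => by
    rw [← sup_eq_right, ← he_sup, he_inj.eq_iff, sup_eq_right]
  exact ⟨op P, ⟨(BddDistLat.Iso.mk (α := L) (β := BddDistLat.of (ClopenUpperSet P.carrier))
    (RelIso.ofSurjective (OrderEmbedding.ofMapLEIff e he_le) he_surj)).symm⟩⟩⟩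

theorem functorK_isEquivalence : (functorK.{u}).IsEquivalence :=
  ⟨functorK_faithful, functorK_full, functorK_essSurj⟩

theorem toDD_isEquivalence : (toDD.{u}).IsEquivalence := by
  have := functorD_isEquivalence.{u}
  have := functorF_isEquivalence.{u}
  have := functorK_isEquivalence.{u}
  -- Regrouped this way, the composite visibly consists of equivalences, and it agrees with `toDD`
  -- on components by definition.
  let i : functorD.rightOp ⋙ functorF.op ⋙ (prodOpEquiv Pries.{u}).functor ⋙
      functorK.prod functorK ≅ toDD.{u} :=
    NatIso.ofComponents (fun A => Iso.refl _) fun _ => rfl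
  have : (functorK.prod functorK).IsEquivalence :=
    (functorK.asEquivalence.prod functorK.asEquivalence).isEquivalence_functor
  exact Functor.isEquivalence_of_iso i

end PreBilat

theorem theorem10p2 :
    -- `DPB = ISP(2⁺, 2⁻)`
    (∀ (A : Type u) [Ops A], IsDPB A ↔ InISP A) ∧
    -- the alter ego yields a strong (hence full) natural duality
    YieldsStrongDuality.{u} ∧ YieldsFullDuality.{u} ∧ AlterEgoInjective.{u} ∧
    -- dual equivalence between `DPB` and the category `IS_cP` of the alter ego
    DualEquivalence.{u} ∧
    -- the dual category is the category of pairs of Priestley spaces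
    (∀ X : TwoSorted.{u}, InIScP X ↔ SortsArePriestley X) ∧
    (functorF.{u}).IsEquivalence ∧
    -- `DPB` is equivalent to the square of the category of bounded distributive lattices
    (toDD.{u}).IsEquivalence := by
  exact ⟨fun A _ => isDPB_iff_inISP, yieldsStrongDuality, yieldsFullDuality, alterEgoInjective,
    dualEquivalence, fun X => inIScP_iff_sortsArePriestley, functorF_isEquivalence,
    toDD_isEquivalence⟩
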